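/- Let $n\ge 0$ and $[n]=\{1,\dots,n\}$. For $w\in S_n$ let $E_{val}(w)=\{w(i) : i\in[n],\ i\le w(i)\}$ and $E_{pos}(w)=\{i\in[n] : i\le w(i)\}$ be the sets of weak excedance values and weak excedance positions of $w$. Write $v\sim w$ if $E_{val}(v)=E_{val}(w)$ and $E_{pos}(v)=E_{pos}(w)$; the equivalence classes of $\sim$ on $S_n$ are called excedance classes. The Bruhat order on $S_n$ is the partial order generated by the relations $v<w$ whenever $wv^{-1}$ is a transposition and $\ell(v)<\ell(w)$, where $\ell$ is the number of inversions. It induces the following relation on excedance classes: $\mathcal A\le\mathcal B$ if and only if $v\le w$ in the Bruhat order for some $v\in\mathcal A$ and some $w\in\mathcal B$. A noncrossing partition of size $n$ is a set $\lambda$ of arcs $(i,j)$ with $1\le i<j\le n$ that contains no two distinct arcs $(i,k)$, $(j,l)$ with $i\le j<k\le l$. Let $\lambda^{+}$ be the set of left endpoints and $\lambda^{-}$ the set of right endpoints of the arcs of $\lambda$, and put $$\mathcal C_\lambda=\{w\in S_n : E_{val}(w)=[n]\setminus\lambda^{+},\ E_{pos}(w)=[n]\setminus\lambda^{-}\}.$$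 Let $\preceq$ be the reflexive transitive closure, on the set of noncrossing partitions of size $n$, of the following relation: $\lambda$ is covered by $\mu$ if the noncrossing partition $\lambda$ is obtained from $\mu$ either by removing an arc of the form $(i,i+1)$, or by replacing an arc $(i,k)$ by two arcs $(i,j)$ and $(j,k)$ for some $i<j<k$, where the new arcs neither cross nor share a left or right endpoint with any other arc of $\mu$. Then $\lambda\mapsto\mathcal C_\lambda$ is a bijection from the set of noncrossing partitions of size $n$ onto the set of excedance classes of $S_n$. For all noncrossing partitions $\lambda,\mu$ of size $n$, $$\mathcal C_\lambda\le\mathcal C_\mu\quad\text{if and only if}\quad\lambda\preceq\mu.$$ In particular, the induced relation $\le$ is a partial order on the set of excedance classes. -/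

import Mathlib

/-- A noncrossing partition of size `n`: a set of arcs `(i, j)` with `i < j` on the points of
`Fin n` (the points `1, …, n` of the diagram, shifted to `0, …, n - 1`), containing no two distinct
arcs `(i, k)` and `(j, l)` with `i ≤ j < k ≤ l`. -/
@[ext]
structure NCP (n : ℕ) where
  arcs : Finset (Fin n × Fin n)
  lt_of_mem : ∀ a ∈ arcs, a.1 < a.2
  noncrossing : ∀ a ∈ arcs, ∀ b ∈ arcs, a ≠ b → ¬ (a.1 ≤ b.1 ∧ b.1 < a.2 ∧ a.2 ≤ b.2)

namespace NCP

variable {n : ℕ}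

/-- The set of left endpoints of the arcs. -/
def leftEnds (lam : NCP n) : Set (Fin n) := {i | ∃ j, (i, j) ∈ lam.arcs}

/-- The set of right endpoints of the arcs. -/
def rightEnds (lam : NCP n) : Set (Fin n) := {j | ∃ i, (i, j) ∈ lam.arcs}

/-- `lam` is obtained from `mu` by removing an arc joining two consecutive points. -/
def RemovesShortArc (lam mu : NCP n) : Prop :=
  ∃ i j : Fin n, (j : ℕ) = (i : ℕ) + 1 ∧ (i, j) ∈ mu.arcs ∧ lam.arcs = mu.arcs.erase (i, j)

/-- `lam` is obtained from `mu` by replacing an arc `(i, k)` by `(i, j)` and `(j, k)`, where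
`i < j < k`. That the new arcs neither cross the other arcs of `mu` nor share a left or a right
endpoint with them is the requirement that `lam` is again a noncrossing partition. -/
def SplitsArc (lam mu : NCP n) : Prop :=
  ∃ i j k : Fin n, i < j ∧ j < k ∧ (i, k) ∈ mu.arcs ∧
    lam.arcs = insert (i, j) (insert (j, k) (mu.arcs.erase (i, k)))

/-- The covering relation: `lam` is covered by `mu`. -/
def CoveredBy (lam mu : NCP n) : Prop := RemovesShortArc lam mu ∨ SplitsArc lam mu

/-- The order `lam ⪯ mu`: the reflexive transitive closure of the covering relation. -/
def Prec (lam mu : NCP n) : Prop := Relation.ReflTransGen CoveredBy lam mu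

end NCP

namespace ExcedanceQuotient

variable {n : ℕ}

/-- The length of a permutation: its number of inversions. -/
def length (w : Equiv.Perm (Fin n)) : ℕ :=
  (Finset.univ.filter (fun p : Fin n × Fin n => p.1 < p.2 ∧ w p.2 < w p.1)).card

/-- The generating relation of the Bruhat order. -/
def BruhatStep (v w : Equiv.Perm (Fin n)) : Prop :=
  (w * v⁻¹).IsSwap ∧ length v < length w

/-- The Bruhat order on the symmetric group. -/
def BruhatLE (v w : Equiv.Perm (Fin n)) : Prop := Relation.ReflTransGen BruhatStep v w

/-- The set of weak excedance values of `w`. -/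
def excVal (w : Equiv.Perm (Fin n)) : Set (Fin n) := {x | ∃ i, i ≤ w i ∧ w i = x}

/-- The set of weak excedance positions of `w`. -/
def excPos (w : Equiv.Perm (Fin n)) : Set (Fin n) := {i | i ≤ w i}

/-- The excedance relation on the symmetric group. -/
def excSetoid (n : ℕ) : Setoid (Equiv.Perm (Fin n)) where
  r v w := excVal v = excVal w ∧ excPos v = excPos w
  iseqv :=
    { refl := fun _ => ⟨rfl, rfl⟩
      symm := fun h => ⟨h.1.symm, h.2.symm⟩
      trans := fun h h' => ⟨h.1.trans h'.1, h.2.trans h'.2⟩ }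

/-- The set of permutations attached to a noncrossing partition: weak excedance values are the
points that are not left endpoints, weak excedance positions those that are not right endpoints. -/
def excClass (lam : NCP n) : Set (Equiv.Perm (Fin n)) :=
  {w | excVal w = lam.leftEndsᶜ ∧ excPos w = lam.rightEndsᶜ}

/-- The relation on sets of permutations (in particular on excedance classes) induced by the
Bruhat order: some element of `A` lies below some element of `B`. -/
def ClassLE (A B : Set (Equiv.Perm (Fin n))) : Prop := ∃ v ∈ A, ∃ w ∈ B, BruhatLE v w

end ExcedanceQuotient

/-! For an arc set, let d(m,k) be the number of arcs starting before m and ending at or after k. On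
the points with m ≤ k ≤ m+1, the quantity 2d(m,k) + (k-m) traces a path with steps ±1 that is read
off from the left and right endpoints, so a noncrossing partition is encoded by its path.
`Dominated` compares these paths pointwise.

The arcs (w r, r) with w r < r of a permutation w have the same left and right endpoints as the
partition of its class. Hence for k ≤ m+1 the number d is a class invariant
(`depth_permArcs_of_mem`), while for m ≤ k it is a rank number of w, monotone in the Bruhat order
(`BruhatStep.depth_le`). Both apply near the diagonal, so comparable classes have comparable paths.

If one path lies strictly below another at some points, the upper path has a peak at the highest
such point. Flattening the peak means removing a short arc or splitting an arc, and the lower path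
stays below (`Dominated.exists_coveredBy`); induction on `area` gives `Prec`. Conversely, each cover
lifts to one Bruhat step between noncrossing permutations (`IsRep`), which closes the circle.

For surjectivity onto the classes, a longest permutation of a class has noncrossing arcs, since
uncrossing two arcs would lengthen it within the class. -/

namespace NCP

variable {n : ℕ}

/-! ### Depths near the diagonal and recovery from endpoints -/

/-- The number of arcs of `S` starting before `m` and ending at or after `k`. -/
def depth (S : Finset (Fin n × Fin n)) (m k : ℕ) : ℕ :=
  (S.filter fun a => (a.1 : ℕ) < m ∧ k ≤ (a.2 : ℕ)).card

/-- A set of arcs in which no two arcs share a left or a right endpoint. -/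
structure IsArcSet (S : Finset (Fin n × Fin n)) : Prop where
  lt : ∀ a ∈ S, a.1 < a.2
  fst_inj : Set.InjOn Prod.fst (S : Set (Fin n × Fin n))
  snd_inj : Set.InjOn Prod.snd (S : Set (Fin n × Fin n))

theorem isArcSet (lam : NCP n) : IsArcSet lam.arcs where
  lt := lam.lt_of_mem
  fst_inj := by
    intro a ha b hb hab
    by_contra hne
    have h1 := lam.noncrossing a ha b hb hne
    have h2 := lam.noncrossing b hb a ha (Ne.symm hne)
    have h3 := lam.lt_of_mem a ha
    have h4 := lam.lt_of_mem b hb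
    simp only [Fin.lt_def, Fin.le_def, Fin.ext_iff] at *
    omega
  snd_inj := by
    intro a ha b hb hab
    by_contra hne
    have h1 := lam.noncrossing a ha b hb hne
    have h2 := lam.noncrossing b hb a ha (Ne.symm hne)
    have h3 := lam.lt_of_mem a ha
    have h4 := lam.lt_of_mem b hb
    simp only [Fin.lt_def, Fin.le_def, Fin.ext_iff] at *
    omega

theorem left_unique (lam : NCP n) {i j k : Fin n} (h : (i, k) ∈ lam.arcs)
    (h' : (j, k) ∈ lam.arcs) : i = j :=
  congrArg Prod.fst (lam.isArcSet.snd_inj (x₁ := (i, k)) (x₂ := (j, k)) h h' rfl)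

theorem right_unique (lam : NCP n) {i j k : Fin n} (h : (i, j) ∈ lam.arcs)
    (h' : (i, k) ∈ lam.arcs) : j = k :=
  congrArg Prod.snd (lam.isArcSet.fst_inj (x₁ := (i, j)) (x₂ := (i, k)) h h' rfl)

theorem card_filter_fst {S : Finset (Fin n × Fin n)} (hS : IsArcSet S) (m : ℕ) :
    (S.filter fun a => (a.1 : ℕ) < m).card
      = ((S.image Prod.fst).filter fun i : Fin n => (i : ℕ) < m).card := by
  rw [Finset.filter_image, Finset.card_image_of_injOn]
  exact hS.fst_inj.mono (by intro a; simp; tauto)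

theorem card_filter_snd {S : Finset (Fin n × Fin n)} (hS : IsArcSet S) (m : ℕ) :
    (S.filter fun a => (a.2 : ℕ) < m).card
      = ((S.image Prod.snd).filter fun i : Fin n => (i : ℕ) < m).card := by
  rw [Finset.filter_image, Finset.card_image_of_injOn]
  exact hS.snd_inj.mono (by intro a; simp; tauto)

/-- An arc ending before k starts before k-1 ≤ m, so the arcs starting before m split into those
ending before k and those counted by the depth. -/
theorem depth_add_card {S : Finset (Fin n × Fin n)} (hS : IsArcSet S) {m k : ℕ} (hk : k ≤ m + 1) :
    depth S m k + (S.filter fun a => (a.2 : ℕ) < k).card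
      = (S.filter fun a => (a.1 : ℕ) < m).card := by
  rw [depth, ← Finset.card_union_of_disjoint]
  · congr 1
    ext a
    simp only [Finset.mem_union, Finset.mem_filter]
    by_cases ha : a ∈ S
    · have := hS.lt a ha
      rw [Fin.lt_def] at this
      simp only [ha, true_and]
      omega
    · simp [ha]
  · rw [Finset.disjoint_filter]
    intro a _ h
    omega

/-- Near the diagonal, the depth is determined by the sets of left and right endpoints. -/
theorem depth_eq_of_image_eq {S T : Finset (Fin n × Fin n)} (hS : IsArcSet S) (hT : IsArcSet T)
    (h1 : S.image Prod.fst = T.image Prod.fst) (h2 : S.image Prod.snd = T.image Prod.snd)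
    {m k : ℕ} (hk : k ≤ m + 1) : depth S m k = depth T m k := by
  have hs := depth_add_card hS hk
  have ht := depth_add_card hT hk
  rw [card_filter_fst hS, card_filter_snd hS] at hs
  rw [card_filter_fst hT, card_filter_snd hT, ← h1, ← h2] at ht
  omega

theorem mem_leftEnds_iff {lam : NCP n} {i : Fin n} :
    i ∈ lam.leftEnds ↔ i ∈ lam.arcs.image Prod.fst := by
  simp [leftEnds]

theorem mem_rightEnds_iff {lam : NCP n} {i : Fin n} :
    i ∈ lam.rightEnds ↔ i ∈ lam.arcs.image Prod.snd := by
  simp [rightEnds]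

/-- A noncrossing partition is determined by the endpoints of its arcs. -/
theorem ext_of_ends {lam mu : NCP n} (hl : lam.leftEnds = mu.leftEnds)
    (hr : lam.rightEnds = mu.rightEnds) : lam = mu := by
  -- Induction on arc length, with both partitions quantified so that the hypothesis can be applied
  -- in the reverse direction. The arcs of `mu` at i and at j cannot be shorter than (i, j); if they
  -- are both longer, they cross.
  have key : ∀ d : ℕ, ∀ lam mu : NCP n, lam.leftEnds = mu.leftEnds →
      lam.rightEnds = mu.rightEnds → ∀ i j : Fin n, (j : ℕ) - (i : ℕ) = d →
      (i, j) ∈ lam.arcs → (i, j) ∈ mu.arcs := by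
    intro d
    induction d using Nat.strong_induction_on with
    | _ d ih =>
      intro lam mu hl hr i j hd hij
      obtain ⟨k, hk⟩ : i ∈ mu.leftEnds := hl ▸ ⟨j, hij⟩
      obtain ⟨p, hp⟩ : j ∈ mu.rightEnds := hr ▸ ⟨i, hij⟩
      have h1 := lam.lt_of_mem _ hij
      have h2 := mu.lt_of_mem _ hk
      have h3 := mu.lt_of_mem _ hp
      simp only [Fin.lt_def] at h1 h2 h3
      by_cases hkj : k = j
      · exact hkj ▸ hk
      have hk' : (j : ℕ) < k := by
        by_contra hlt
        have hlt' : (k : ℕ) < j := by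
          have := fun h => hkj (Fin.ext h)
          omega
        exact hkj (lam.right_unique (ih _ (by omega) mu lam hl.symm hr.symm i k rfl hk) hij)
      by_cases hpi : p = i
      · exact hpi ▸ hp
      have hp' : (p : ℕ) < i := by
        by_contra hlt
        have hlt' : (i : ℕ) < p := by
          have := fun h => hpi (Fin.ext h)
          omega
        exact hpi (lam.left_unique (ih _ (by omega) mu lam hl.symm hr.symm p j rfl hp) hij)
      refine absurd ?_ (mu.noncrossing _ hp _ hk fun h => hkj (congrArg Prod.snd h).symm)
      simp only [Fin.lt_def, Fin.le_def]
      omega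
  refine NCP.ext (Finset.ext fun a => ⟨fun h => ?_, fun h => ?_⟩)
  · exact key _ lam mu hl hr a.1 a.2 rfl h
  · exact key _ mu lam hl.symm hr.symm a.1 a.2 rfl h

-- Together with `depth_succ_right`, this describes the steps of the path: it can rise in depth only
-- at left endpoints and fall only at right endpoints.
open Classical in
theorem depth_succ_left (lam : NCP n) (i : Fin n) :
    depth lam.arcs (i + 1) (i + 1) = depth lam.arcs i (i + 1) +
      (if i ∈ lam.leftEnds then 1 else 0) := by
  have hsplit : depth lam.arcs (i + 1) (i + 1) = depth lam.arcs i (i + 1) +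
      (lam.arcs.filter fun a => a.1 = i).card := by
    rw [depth, depth, ← Finset.card_union_of_disjoint]
    · congr 1
      ext a
      simp only [Finset.mem_union, Finset.mem_filter, Fin.ext_iff]
      by_cases ha : a ∈ lam.arcs
      · have := lam.lt_of_mem a ha
        rw [Fin.lt_def] at this
        simp only [ha, true_and]
        omega
      · simp [ha]
    · rw [Finset.disjoint_filter]
      intro a _ h
      simp only [Fin.ext_iff]
      omega
  rw [hsplit]
  congr 1
  split_ifs with h
  · obtain ⟨j, hj⟩ := h
    rw [Finset.card_eq_one]
    refine ⟨(i, j), Finset.ext fun a => ?_⟩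
    simp only [Finset.mem_filter, Finset.mem_singleton]
    constructor
    · rintro ⟨ha, rfl⟩
      exact lam.isArcSet.fst_inj ha hj rfl
    · rintro rfl
      exact ⟨hj, rfl⟩
  · rw [Finset.card_eq_zero, Finset.filter_eq_empty_iff]
    rintro a ha rfl
    exact h ⟨a.2, ha⟩

open Classical in
theorem depth_succ_right (lam : NCP n) (i : Fin n) :
    depth lam.arcs i i = depth lam.arcs i (i + 1) +
      (if i ∈ lam.rightEnds then 1 else 0) := by
  have hsplit : depth lam.arcs i i = depth lam.arcs i (i + 1) +
      (lam.arcs.filter fun a => a.2 = i).card := by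
    rw [depth, depth, ← Finset.card_union_of_disjoint]
    · congr 1
      ext a
      simp only [Finset.mem_union, Finset.mem_filter, Fin.ext_iff]
      by_cases ha : a ∈ lam.arcs
      · have := lam.lt_of_mem a ha
        rw [Fin.lt_def] at this
        simp only [ha, true_and]
        omega
      · simp [ha]
    · rw [Finset.disjoint_filter]
      intro a _ h
      simp only [Fin.ext_iff]
      omega
  rw [hsplit]
  congr 1
  split_ifs with h
  · obtain ⟨j, hj⟩ := h
    rw [Finset.card_eq_one]
    refine ⟨(j, i), Finset.ext fun a => ?_⟩
    simp only [Finset.mem_filter, Finset.mem_singleton]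
    constructor
    · rintro ⟨ha, rfl⟩
      exact lam.isArcSet.snd_inj ha hj rfl
    · rintro rfl
      exact ⟨hj, rfl⟩
  · rw [Finset.card_eq_zero, Finset.filter_eq_empty_iff]
    rintro a ha rfl
    exact h ⟨a.1, ha⟩

/-! ### Domination of paths and the covering relation -/

/-- Pointwise comparison of the lattice paths recorded by the depths near the diagonal. -/
def Dominated (lam mu : NCP n) : Prop :=
  ∀ m k : ℕ, m ≤ k → k ≤ m + 1 → depth lam.arcs m k ≤ depth mu.arcs m k

theorem eq_of_depth_eq {lam mu : NCP n}
    (h : ∀ m k : ℕ, m ≤ k → k ≤ m + 1 → depth lam.arcs m k = depth mu.arcs m k) : lam = mu := by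
  apply ext_of_ends
  · ext i
    have h1 := lam.depth_succ_left i
    have h2 := mu.depth_succ_left i
    rw [h _ _ le_rfl (by omega), h _ _ (by omega) le_rfl] at h1
    by_cases hl : i ∈ lam.leftEnds <;> by_cases hm : i ∈ mu.leftEnds <;> simp_all
  · ext i
    have h1 := lam.depth_succ_right i
    have h2 := mu.depth_succ_right i
    rw [h _ _ le_rfl (by omega), h _ _ (by omega) le_rfl] at h1
    by_cases hl : i ∈ lam.rightEnds <;> by_cases hm : i ∈ mu.rightEnds <;> simp_all

theorem Dominated.antisymm {lam mu : NCP n} (h : Dominated lam mu) (h' : Dominated mu lam) :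
    lam = mu :=
  eq_of_depth_eq fun m k h1 h2 => le_antisymm (h m k h1 h2) (h' m k h1 h2)

/-- An arbitrary arc statistic `f` is allowed, as in `sum_of_splitsArc`, so that both `area` and
`depth` are covered. -/
theorem sum_of_removesShortArc {lam mu : NCP n} {i j : Fin n} (hij : (i, j) ∈ mu.arcs)
    (h : lam.arcs = mu.arcs.erase (i, j)) (f : Fin n × Fin n → ℕ) :
    ∑ a ∈ lam.arcs, f a + f (i, j) = ∑ a ∈ mu.arcs, f a := by
  rw [h, Finset.sum_erase_add _ _ hij]

theorem sum_of_splitsArc {lam mu : NCP n} {i j k : Fin n} (hij : i < j) (hjk : j < k)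
    (hik : (i, k) ∈ mu.arcs)
    (h : lam.arcs = insert (i, j) (insert (j, k) (mu.arcs.erase (i, k))))
    (f : Fin n × Fin n → ℕ) :
    ∑ a ∈ lam.arcs, f a + f (i, k) = ∑ a ∈ mu.arcs, f a + f (i, j) + f (j, k) := by
  rw [h, Finset.sum_insert, Finset.sum_insert, ← Finset.sum_erase_add _ _ hik]
  · ring
  · rw [Finset.mem_erase]
    rintro ⟨-, h'⟩
    exact hij.ne (mu.left_unique hik h')
  · rw [Finset.mem_insert, Finset.mem_erase, Prod.mk.injEq]
    rintro (h' | ⟨-, h'⟩)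
    · exact hij.ne h'.1
    · exact hjk.ne (mu.right_unique h' hik)

/-- The area under the lattice path of a noncrossing partition. -/
def area (lam : NCP n) : ℕ := ∑ a ∈ lam.arcs, (2 * ((a.2 : ℕ) - (a.1 : ℕ)) - 1)

theorem CoveredBy.area_lt {lam mu : NCP n} (h : CoveredBy lam mu) : area lam < area mu := by
  rcases h with ⟨i, j, hij, hmem, h⟩ | ⟨i, j, k, hij, hjk, hmem, h⟩
  · have := sum_of_removesShortArc hmem h fun a => 2 * ((a.2 : ℕ) - (a.1 : ℕ)) - 1
    simp only [area]
    simp only at this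
    omega
  · have := sum_of_splitsArc hij hjk hmem h fun a => 2 * ((a.2 : ℕ) - (a.1 : ℕ)) - 1
    rw [Fin.lt_def] at hij hjk
    simp only [area]
    simp only at this
    omega

theorem depth_eq_sum (S : Finset (Fin n × Fin n)) (m k : ℕ) :
    depth S m k = ∑ a ∈ S, if (a.1 : ℕ) < m ∧ k ≤ (a.2 : ℕ) then 1 else 0 := by
  rw [depth, Finset.card_filter]

theorem depth_removesShortArc {lam mu : NCP n} {i j : Fin n} (hij : (j : ℕ) = (i : ℕ) + 1)
    (hmem : (i, j) ∈ mu.arcs) (h : lam.arcs = mu.arcs.erase (i, j)) {m k : ℕ} (hmk : m ≤ k) :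
    depth lam.arcs m k + (if m = j ∧ k = j then 1 else 0) = depth mu.arcs m k := by
  rw [depth_eq_sum, depth_eq_sum, ← sum_of_removesShortArc hmem h]
  congr 1
  exact if_congr (by constructor <;> (simp only; omega)) rfl rfl

/-- Splitting loses exactly the points with i < m ≤ j < p ≤ k; near the diagonal only (j, j+1) is
left. -/
theorem depth_splitsArc {lam mu : NCP n} {i j k : Fin n} (hij : i < j) (hjk : j < k)
    (hmem : (i, k) ∈ mu.arcs)
    (h : lam.arcs = insert (i, j) (insert (j, k) (mu.arcs.erase (i, k)))) {m p : ℕ}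
    (hmp : m ≤ p) (hpm : p ≤ m + 1) :
    depth lam.arcs m p + (if m = j ∧ p = j + 1 then 1 else 0) = depth mu.arcs m p := by
  have := sum_of_splitsArc hij hjk hmem h
    fun a => if (a.1 : ℕ) < m ∧ p ≤ (a.2 : ℕ) then 1 else 0
  rw [Fin.lt_def] at hij hjk
  rw [depth_eq_sum, depth_eq_sum]
  simp only at this
  split_ifs at this ⊢ <;> omega

/-- Removing an arc. -/
def eraseArc (mu : NCP n) (a : Fin n × Fin n) : NCP n where
  arcs := mu.arcs.erase a
  lt_of_mem b hb := mu.lt_of_mem b (Finset.mem_of_mem_erase hb)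
  noncrossing b hb c hc :=
    mu.noncrossing b (Finset.mem_of_mem_erase hb) c (Finset.mem_of_mem_erase hc)

/-- The innermost arc over a point that is not an endpoint can be split at that point. -/
theorem exists_splitsArc {mu : NCP n} {j : Fin n} (hl : j ∉ mu.leftEnds) (hr : j ∉ mu.rightEnds)
    (hpos : 0 < depth mu.arcs j (j + 1)) :
    ∃ (lam : NCP n) (i k : Fin n), i < j ∧ j < k ∧ (i, k) ∈ mu.arcs ∧
      lam.arcs = insert (i, j) (insert (j, k) (mu.arcs.erase (i, k))) := by
  -- The innermost arc over j is the one with the largest left endpoint.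
  obtain ⟨⟨a, c⟩, ha, hmax⟩ :=
    Finset.exists_max_image _ (fun a : Fin n × Fin n => (a.1 : ℕ)) (Finset.card_pos.1 hpos)
  simp only [Finset.mem_filter] at ha hmax
  obtain ⟨hac, haj, hjc⟩ := ha
  have hjc' : (j : ℕ) < c := hjc
  have hleft : ∀ p q : Fin n, (p, q) ∈ mu.arcs → (p : ℕ) ≠ j :=
    fun p q h e => hl ⟨q, Fin.ext e ▸ h⟩
  have hright : ∀ p q : Fin n, (p, q) ∈ mu.arcs → (q : ℕ) ≠ j :=
    fun p q h e => hr ⟨p, Fin.ext e ▸ h⟩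
  refine ⟨⟨insert (a, j) (insert (j, c) (mu.arcs.erase (a, c))), ?_, ?_⟩, a, c, haj, hjc', hac,
    rfl⟩
  · intro b hb
    simp only [Finset.mem_insert, Finset.mem_erase] at hb
    rcases hb with rfl | rfl | ⟨-, hb⟩
    · exact haj
    · exact hjc'
    · exact mu.lt_of_mem b hb
  · have hold : ∀ p q : Fin n, (p, q) ∈ mu.arcs → (p, q) ≠ (a, c) →
        ¬ ((a : ℕ) ≤ p ∧ (p : ℕ) < c ∧ (c : ℕ) ≤ q) ∧
        ¬ ((p : ℕ) ≤ a ∧ (a : ℕ) < q ∧ (q : ℕ) ≤ c) ∧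
        ¬ ((a : ℕ) < p ∧ (p : ℕ) < j ∧ (j : ℕ) < q) ∧ (p : ℕ) ≠ j ∧ (q : ℕ) ≠ j ∧
        (p : ℕ) ≠ a := by
      intro p q h hne
      refine ⟨mu.noncrossing _ hac _ h (Ne.symm hne), mu.noncrossing _ h _ hac hne, ?_,
        hleft p q h, hright p q h, ?_⟩
      · rintro ⟨h1, h2, h3⟩
        have := hmax (p, q) ⟨h, h2, h3⟩
        simp only at this
        omega
      · intro e
        obtain rfl := Fin.ext e
        exact hne (by rw [mu.right_unique h hac])
    rintro ⟨p, q⟩ hb ⟨p', q'⟩ hb' hne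
    simp only [Finset.mem_insert, Finset.mem_erase] at hb hb'
    simp only [Fin.lt_def, Fin.le_def]
    rcases hb with hb | hb | ⟨hn, hb⟩ <;> rcases hb' with hb' | hb' | ⟨hn', hb'⟩
    · exact absurd (hb.trans hb'.symm) hne
    · simp only [Prod.mk.injEq, Fin.ext_iff] at hb hb'
      omega
    · have := hold _ _ hb' hn'
      simp only [Prod.mk.injEq, Fin.ext_iff] at hb
      omega
    · simp only [Prod.mk.injEq, Fin.ext_iff] at hb hb'
      omega
    · exact absurd (hb.trans hb'.symm) hne
    · have := hold _ _ hb' hn'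
      simp only [Prod.mk.injEq, Fin.ext_iff] at hb
      omega
    · have := hold _ _ hb hn
      simp only [Prod.mk.injEq, Fin.ext_iff] at hb'
      omega
    · have := hold _ _ hb hn
      simp only [Prod.mk.injEq, Fin.ext_iff] at hb'
      omega
    · exact mu.noncrossing _ hb _ hb' hne

theorem depth_eq_zero (S : Finset (Fin n × Fin n)) {m k : ℕ} (h : m = 0 ∨ n ≤ k) :
    depth S m k = 0 := by
  rw [depth, Finset.card_eq_zero, Finset.filter_eq_empty_iff]
  intro a _
  have := a.2.isLt
  omega

/-- A highest point of `mu` among those strictly above `lam` is a peak: at a higher neighbour the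
paths would agree, but there the path of `lam` is still at least two units lower. -/
theorem Dominated.exists_coveredBy {lam mu : NCP n} (h : Dominated lam mu) (hne : lam ≠ mu) :
    ∃ nu, CoveredBy nu mu ∧ Dominated lam nu := by
  classical
  let bad : Finset (ℕ × ℕ) := (Finset.range n ×ˢ Finset.range n).filter fun p =>
    p.1 ≤ p.2 ∧ p.2 ≤ p.1 + 1 ∧ depth lam.arcs p.1 p.2 < depth mu.arcs p.1 p.2
  have hbad : bad.Nonempty := by
    by_contra hcon
    rw [Finset.not_nonempty_iff_eq_empty, Finset.filter_eq_empty_iff] at hcon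
    refine hne (eq_of_depth_eq fun m k h1 h2 => ?_)
    by_cases hk : n ≤ k
    · rw [depth_eq_zero _ (Or.inr hk), depth_eq_zero _ (Or.inr hk)]
    · refine le_antisymm (h m k h1 h2) (not_lt.1 fun hlt => ?_)
      exact hcon (x := (m, k)) (by simp; omega) ⟨h1, h2, hlt⟩
  -- The term `p.2 - p.1` turns twice the depth into a height that changes by ±1 at every step.
  obtain ⟨⟨m, k⟩, hmk, hmax⟩ := Finset.exists_max_image bad
    (fun p => 2 * depth mu.arcs p.1 p.2 + (p.2 - p.1)) hbad
  have hagree : ∀ m' k' : ℕ, m' ≤ k' → k' ≤ m' + 1 →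
      2 * depth mu.arcs m k + (k - m) < 2 * depth mu.arcs m' k' + (k' - m') →
      depth lam.arcs m' k' = depth mu.arcs m' k' := by
    intro m' k' h1 h2 hlt
    by_cases hk : n ≤ k'
    · rw [depth_eq_zero _ (Or.inr hk), depth_eq_zero _ (Or.inr hk)]
    · refine le_antisymm (h m' k' h1 h2) (not_lt.1 fun hlt' => ?_)
      have hmem : (m', k') ∈ bad := by
        simp only [bad, Finset.mem_filter, Finset.mem_product, Finset.mem_range]
        omega
      have := hmax (m', k') hmem
      simp only at this
      omega
  simp only [bad, Finset.mem_filter, Finset.mem_product, Finset.mem_range] at hmk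
  obtain ⟨⟨hmn, hkn⟩, hmk, hkm, hlt⟩ := hmk
  rcases Nat.eq_or_lt_of_le hmk with rfl | hmk'
  · obtain ⟨i, rfl⟩ : ∃ i, m = i + 1 := by
      refine Nat.exists_eq_succ_of_ne_zero fun h0 => ?_
      rw [depth_eq_zero mu.arcs (Or.inl h0)] at hlt
      omega
    obtain ⟨r, hr⟩ : (⟨i, by omega⟩ : Fin n) ∈ mu.leftEnds := by
      by_contra hcon
      have h1 := mu.depth_succ_left ⟨i, by omega⟩
      have h2 := lam.depth_succ_left ⟨i, by omega⟩
      rw [if_neg hcon] at h1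
      simp only at h1 h2
      have := hagree i (i + 1) (by omega) (by omega) (by omega)
      omega
    obtain ⟨l, hl⟩ : (⟨i + 1, hmn⟩ : Fin n) ∈ mu.rightEnds := by
      by_contra hcon
      have h1 := mu.depth_succ_right ⟨i + 1, hmn⟩
      have h2 := lam.depth_succ_right ⟨i + 1, hmn⟩
      rw [if_neg hcon] at h1
      simp only at h1 h2
      have := hagree (i + 1) (i + 1 + 1) (by omega) (by omega) (by omega)
      omega
    -- An arc ending at i+1 and a different arc starting at i would cross.
    have harc : ((⟨i, by omega⟩ : Fin n), (⟨i + 1, hmn⟩ : Fin n)) ∈ mu.arcs := by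
      by_contra hcon
      have h1 := mu.lt_of_mem _ hr
      have h2 := mu.lt_of_mem _ hl
      refine mu.noncrossing _ hl _ hr (fun e => hcon ?_) ?_
      · rw [Prod.mk.injEq] at e
        exact e.1 ▸ hl
      · simp only [Fin.lt_def, Fin.le_def] at h1 h2 ⊢
        omega
    refine ⟨mu.eraseArc _, Or.inl ⟨_, _, rfl, harc, rfl⟩, fun m' k' h1 h2 => ?_⟩
    have h3 := depth_removesShortArc (lam := mu.eraseArc _) rfl harc rfl h1
    have h4 := h m' k' h1 h2
    split_ifs at h3 with hc
    · obtain ⟨rfl, rfl⟩ := hc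
      simp only at h3 hlt h4 ⊢
      omega
    · omega
  · obtain rfl : k = m + 1 := by omega
    have hl : (⟨m, hmn⟩ : Fin n) ∉ mu.leftEnds := by
      intro hcon
      have h1 := mu.depth_succ_left ⟨m, hmn⟩
      have h2 := lam.depth_succ_left ⟨m, hmn⟩
      rw [if_pos hcon] at h1
      simp only at h1 h2
      have := hagree (m + 1) (m + 1) (by omega) (by omega) (by omega)
      split_ifs at h2 <;> omega
    have hr : (⟨m, hmn⟩ : Fin n) ∉ mu.rightEnds := by
      intro hcon
      have h1 := mu.depth_succ_right ⟨m, hmn⟩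
      have h2 := lam.depth_succ_right ⟨m, hmn⟩
      rw [if_pos hcon] at h1
      simp only at h1 h2
      have := hagree m m (by omega) (by omega) (by omega)
      split_ifs at h2 <;> omega
    obtain ⟨nu, i, k, hij, hjk, hik, hnu⟩ := exists_splitsArc hl hr (by simp only; omega)
    refine ⟨nu, Or.inr ⟨i, _, k, hij, hjk, hik, hnu⟩, fun m' k' h1 h2 => ?_⟩
    have h3 := depth_splitsArc hij hjk hik hnu h1 h2
    have h4 := h m' k' h1 h2
    split_ifs at h3 with hc
    · obtain ⟨rfl, rfl⟩ := hc
      simp only at h3 hlt h4 ⊢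
      omega
    · omega

theorem Dominated.prec {lam mu : NCP n} (h : Dominated lam mu) : Prec lam mu := by
  induction hd : area mu using Nat.strong_induction_on generalizing mu with
  | _ d ih =>
    by_cases hne : lam = mu
    · exact hne ▸ Relation.ReflTransGen.refl
    · obtain ⟨nu, hnu, hdom⟩ := h.exists_coveredBy hne
      exact (ih _ (hd ▸ hnu.area_lt) hdom rfl).tail hnu

/-- The noncrossing partition without arcs. -/
def noArcs (n : ℕ) : NCP n where
  arcs := ∅
  lt_of_mem := by simp
  noncrossing := by simp

theorem noArcs_prec (lam : NCP n) : Prec (noArcs n) lam :=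
  Dominated.prec fun m k _ _ => by simp [noArcs, depth]

end NCP

namespace ExcedanceQuotient

variable {n : ℕ}

open NCP Relation

/-! ### Bruhat steps as exchanges of positions -/

/-- Exchanging two entries that are in order increases the length. -/
theorem length_lt_mul_swap (u : Equiv.Perm (Fin n)) {a b : Fin n} (hab : a < b) (hu : u a < u b) :
    length u < length (u * Equiv.swap a b) := by
  classical
  set s := Equiv.swap a b with hs
  -- Relabel a pair by the swap when this keeps its order, and leave it alone otherwise. This
  -- injects the inversions of `u` into those of `u * s` and misses (a, b).
  let φ : Fin n × Fin n → Fin n × Fin n := fun p => if s p.1 < s p.2 then (s p.1, s p.2) else p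
  have hss : ∀ x, s (s x) = x := Equiv.swap_apply_self a b
  have hφ : ∀ p : Fin n × Fin n, p.1 < p.2 → φ (φ p) = p := by
    intro p hp
    by_cases h : s p.1 < s p.2
    · simp [φ, h, hss, hp]
    · simp [φ, h]
  have hφab : φ (a, b) = (a, b) := by
    simp [φ, hs, hab.le]
  have hsub : (Finset.univ.filter (fun p : Fin n × Fin n => p.1 < p.2 ∧ u p.2 < u p.1)).image φ ⊂
      Finset.univ.filter (fun p : Fin n × Fin n => p.1 < p.2 ∧ (u * s) p.2 < (u * s) p.1) := by
    rw [Finset.ssubset_iff_of_subset]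
    · refine ⟨(a, b), by simp [hs, hab, hu], fun hmem => ?_⟩
      obtain ⟨p, hp, hpe⟩ := Finset.mem_image.1 hmem
      rw [Finset.mem_filter] at hp
      have := hφ p hp.2.1
      rw [hpe, hφab] at this
      rw [← this] at hp
      exact lt_asymm hu hp.2.2
    · intro q hq
      obtain ⟨⟨p, q⟩, hp, rfl⟩ := Finset.mem_image.1 hq
      simp only [Finset.mem_filter, Finset.mem_univ, true_and] at hp ⊢
      obtain ⟨hpq, hinv⟩ := hp
      by_cases h : s p < s q
      · simp only [φ, h, if_true, Equiv.Perm.mul_apply, hss]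
        exact ⟨trivial, hinv⟩
      · simp only [φ, h, if_false, Equiv.Perm.mul_apply]
        refine ⟨hpq, ?_⟩
        rw [hs, Equiv.swap_apply_def, Equiv.swap_apply_def] at h ⊢
        split_ifs at h ⊢ <;> subst_vars <;> order
  calc length u = _ := (Finset.card_image_of_injOn fun p hp q hq h => ?_).symm
    _ < _ := Finset.card_lt_card hsub
  simp only [Finset.coe_filter, Set.mem_ofPred_eq, Finset.mem_univ, true_and] at hp hq
  rw [← hφ p hp.1, ← hφ q hq.1, h]

theorem bruhatStep_mul_swap (u : Equiv.Perm (Fin n)) {a b : Fin n} (hab : a < b) (hu : u a < u b) :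
    BruhatStep u (u * Equiv.swap a b) := by
  refine ⟨⟨u a, u b, hu.ne, ?_⟩, length_lt_mul_swap u hab hu⟩
  rw [Equiv.swap_apply_apply]

theorem BruhatStep.exists_eq_mul_swap {v w : Equiv.Perm (Fin n)} (h : BruhatStep v w) :
    ∃ a b : Fin n, a < b ∧ v a < v b ∧ w = v * Equiv.swap a b := by
  obtain ⟨⟨x, y, hxy, hs⟩, hlen⟩ := h
  have hw : w = v * Equiv.swap (v⁻¹ x) (v⁻¹ y) := by
    rw [Equiv.swap_apply_apply, ← hs]
    group
  have key : ∀ a b : Fin n, a < b → w = v * Equiv.swap a b → v a < v b := by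
    intro a b hab hwab
    by_contra hcon
    have hlt : v b < v a := lt_of_le_of_ne (not_lt.1 hcon) (v.injective.ne hab.ne')
    have := length_lt_mul_swap w hab (by simpa [hwab] using hlt)
    rw [hwab, mul_assoc, Equiv.swap_mul_self, mul_one, ← hwab] at this
    omega
  rcases lt_or_gt_of_ne (v⁻¹.injective.ne hxy) with h | h
  · exact ⟨_, _, h, key _ _ h hw, hw⟩
  · rw [Equiv.swap_comm] at hw
    exact ⟨_, _, h, key _ _ h hw, hw⟩

/-! ### Arcs and rank numbers of a permutation -/

/-- The arcs `(w r, r)` of a permutation, where `r` runs over the positions that are not weak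
excedance positions. -/
def permArcs (w : Equiv.Perm (Fin n)) : Finset (Fin n × Fin n) :=
  Finset.univ.filter fun a => w a.2 = a.1 ∧ a.1 < a.2

theorem mem_permArcs {w : Equiv.Perm (Fin n)} {l r : Fin n} :
    (l, r) ∈ permArcs w ↔ w r = l ∧ l < r := by
  simp [permArcs]

theorem isArcSet_permArcs (w : Equiv.Perm (Fin n)) : IsArcSet (permArcs w) where
  lt := by
    rintro ⟨l, r⟩ h
    exact (mem_permArcs.1 h).2
  fst_inj := by
    rintro ⟨l, r⟩ h ⟨l', r'⟩ h' e
    have h := mem_permArcs.1 h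
    have h' := mem_permArcs.1 h'
    obtain rfl : l = l' := e
    rw [w.injective (h.1.trans h'.1.symm)]
  snd_inj := by
    rintro ⟨l, r⟩ h ⟨l', r'⟩ h' e
    have h := mem_permArcs.1 h
    have h' := mem_permArcs.1 h'
    obtain rfl : r = r' := e
    rw [← h.1, ← h'.1]

theorem mem_image_fst_permArcs {w : Equiv.Perm (Fin n)} {x : Fin n} :
    x ∈ (permArcs w).image Prod.fst ↔ x ∉ excVal w := by
  simp only [Finset.mem_image, Prod.exists, mem_permArcs, exists_and_right, exists_eq_right,
    excVal, Set.mem_ofPred_eq, not_exists, not_and]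
  constructor
  · rintro ⟨r, rfl, h⟩ i hi e
    rw [w.injective e] at hi
    exact absurd h (not_lt.2 hi)
  · intro h
    refine ⟨w⁻¹ x, by simp, lt_of_not_ge fun hle => h (w⁻¹ x) ?_ (by simp)⟩
    simpa using hle

theorem mem_image_snd_permArcs {w : Equiv.Perm (Fin n)} {i : Fin n} :
    i ∈ (permArcs w).image Prod.snd ↔ i ∉ excPos w := by
  simp only [Finset.mem_image, Prod.exists, mem_permArcs, exists_eq_right, excPos,
    Set.mem_ofPred_eq, not_le]
  constructor
  · rintro ⟨l, rfl, h⟩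
    exact h
  · exact fun h => ⟨_, rfl, h⟩

theorem depth_permArcs_of_mem {lam : NCP n} {w : Equiv.Perm (Fin n)} (hw : w ∈ excClass lam)
    {m k : ℕ} (hk : k ≤ m + 1) : depth (permArcs w) m k = depth lam.arcs m k := by
  refine depth_eq_of_image_eq (isArcSet_permArcs w) lam.isArcSet ?_ ?_ hk
  · ext x
    rw [mem_image_fst_permArcs, hw.1, ← mem_leftEnds_iff, Set.mem_compl_iff, not_not]
  · ext x
    rw [mem_image_snd_permArcs, hw.2, ← mem_rightEnds_iff, Set.mem_compl_iff, not_not]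

/-- When m ≤ k, the inequalities w r < m and k ≤ r already force w r < r, so the restriction to arcs
is vacuous. -/
theorem depth_permArcs (w : Equiv.Perm (Fin n)) {m k : ℕ} (hmk : m ≤ k) :
    depth (permArcs w) m k
      = (Finset.univ.filter fun r : Fin n => (w r : ℕ) < m ∧ k ≤ (r : ℕ)).card := by
  refine Finset.card_nbij' Prod.snd (fun r => (w r, r)) ?_ ?_ ?_ ?_
  · rintro ⟨l, r⟩ h
    obtain ⟨h, h'⟩ := Finset.mem_filter.1 h
    obtain ⟨rfl, -⟩ := mem_permArcs.1 h
    simpa using h'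
  · intro r h
    obtain ⟨h1, h2⟩ : (w r : ℕ) < m ∧ k ≤ (r : ℕ) := by simpa using h
    refine Finset.mem_filter.2 ⟨mem_permArcs.2 ⟨rfl, ?_⟩, h1, h2⟩
    rw [Fin.lt_def]
    omega
  · rintro ⟨l, r⟩ h
    obtain ⟨rfl, -⟩ := mem_permArcs.1 (Finset.mem_filter.1 h).1
    rfl
  · intro r _
    rfl

theorem BruhatStep.depth_le {v w : Equiv.Perm (Fin n)} (h : BruhatStep v w) {m k : ℕ}
    (hmk : m ≤ k) : depth (permArcs v) m k ≤ depth (permArcs w) m k := by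
  obtain ⟨a, b, hab, hv, rfl⟩ := h.exists_eq_mul_swap
  rw [depth_permArcs _ hmk, depth_permArcs _ hmk]
  rw [Fin.lt_def] at hab hv
  -- If both exchanged positions are at least k, the swap matches the counted positions. Otherwise
  -- only b can be affected, and its value decreases.
  by_cases ha : k ≤ (a : ℕ)
  · apply Finset.card_le_card_of_injOn (Equiv.swap a b) _ (Equiv.injective _).injOn
    intro r hr
    obtain ⟨h1, h2⟩ := (Finset.mem_filter.1 hr).2
    refine Finset.mem_filter.2 ⟨Finset.mem_univ _, ?_, ?_⟩
    · rwa [Equiv.Perm.mul_apply, Equiv.swap_apply_self]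
    rw [Equiv.swap_apply_def]
    split_ifs <;> omega
  · apply Finset.card_le_card
    intro r hr
    obtain ⟨h1, h2⟩ := (Finset.mem_filter.1 hr).2
    refine Finset.mem_filter.2 ⟨Finset.mem_univ _, ?_, h2⟩
    rw [Equiv.Perm.mul_apply, Equiv.swap_apply_def]
    split_ifs with h3 h4
    · subst h3; omega
    · subst h4; omega
    · exact h1

theorem dominated_of_classLE {lam mu : NCP n} (h : ClassLE (excClass lam) (excClass mu)) :
    Dominated lam mu := by
  obtain ⟨v, hv, w, hw, hvw⟩ := h
  intro m k h1 h2
  rw [← depth_permArcs_of_mem hv h2, ← depth_permArcs_of_mem hw h2]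
  clear hw
  induction hvw with
  | refl => exact le_rfl
  | tail _ hstep ih => exact ih.trans (hstep.depth_le h1)

/-! ### Noncrossing permutations and lifting of covers -/

/-- `w` is the noncrossing permutation of `lam`: it maps the right endpoint of each arc to its left
endpoint, and every other point to the end of the chain of arcs that starts there. -/
structure IsRep (lam : NCP n) (w : Equiv.Perm (Fin n)) : Prop where
  arc : ∀ l r, (l, r) ∈ lam.arcs → w r = l
  not_mem : ∀ i, i ∉ lam.rightEnds → w i ∉ lam.leftEnds
  chain : ∀ i, i ∉ lam.rightEnds → ReflTransGen (fun x y => (x, y) ∈ lam.arcs) i (w i)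

theorem le_of_chain {lam : NCP n} {i j : Fin n}
    (h : ReflTransGen (fun x y => (x, y) ∈ lam.arcs) i j) : i ≤ j := by
  induction h with
  | refl => exact le_rfl
  | tail _ hstep ih => exact ih.trans (lam.lt_of_mem _ hstep).le

theorem IsRep.mem_excClass {lam : NCP n} {w : Equiv.Perm (Fin n)} (h : IsRep lam w) :
    w ∈ excClass lam := by
  have hpos : ∀ i, i ≤ w i ↔ i ∉ lam.rightEnds := by
    refine fun i => ⟨?_, fun hi => le_of_chain (h.chain i hi)⟩
    rintro hi ⟨l, hl⟩
    rw [h.arc l i hl] at hi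
    exact absurd (lam.lt_of_mem _ hl) (not_lt.2 hi)
  refine ⟨Set.ext fun x => ⟨?_, fun hx => ?_⟩, Set.ext hpos⟩
  · rintro ⟨i, hi, rfl⟩
    exact h.not_mem i ((hpos i).1 hi)
  · refine ⟨w⁻¹ x, (hpos _).2 ?_, by simp⟩
    rintro ⟨l, hl⟩
    have := h.arc _ _ hl
    rw [← Equiv.Perm.mul_apply, mul_inv_cancel, Equiv.Perm.one_apply] at this
    exact hx ⟨w⁻¹ x, this.symm ▸ hl⟩

/-- The arc (i, j) joins the chain ending at i to the chain starting at j. If the former starts at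
a, the swap of a and j merges the two, and a ≤ i < j ≤ v j makes it a Bruhat step. -/
theorem IsRep.exists_of_removesShortArc {lam mu : NCP n} {v : Equiv.Perm (Fin n)}
    (hv : IsRep lam v) (h : RemovesShortArc lam mu) : ∃ w, IsRep mu w ∧ BruhatStep v w := by
  obtain ⟨i, j, hij, hmem, h⟩ := h
  have hlam : ∀ {l r}, (l, r) ∈ lam.arcs → (l, r) ∈ mu.arcs := by
    intro l r hlr
    rw [h] at hlr
    exact Finset.mem_of_mem_erase hlr
  have hmu : ∀ {l r}, (l, r) ∈ mu.arcs → (l = i ∧ r = j) ∨ (l, r) ∈ lam.arcs := by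
    intro l r hlr
    rw [h, Finset.mem_erase, ne_eq, Prod.mk.injEq]
    tauto
  have hmono : ∀ {p q}, ReflTransGen (fun x y => (x, y) ∈ lam.arcs) p q →
      ReflTransGen (fun x y => (x, y) ∈ mu.arcs) p q :=
    fun h => h.lift id fun _ _ => hlam
  have hnot : (i, j) ∉ lam.arcs := by simp [h]
  have hi : i ∉ lam.leftEnds := fun ⟨r, hr⟩ => hnot (mu.right_unique hmem (hlam hr) ▸ hr)
  have hj : j ∉ lam.rightEnds := fun ⟨l, hl⟩ => hnot (mu.left_unique hmem (hlam hl) ▸ hl)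
  obtain ⟨a, rfl⟩ := v.surjective i
  have ha : a ∉ lam.rightEnds := by
    rintro ⟨l, hl⟩
    exact hi ⟨a, (hv.arc _ _ hl).symm ▸ hl⟩
  have hai := le_of_chain (hv.chain a ha)
  have hjc := le_of_chain (hv.chain j hj)
  rw [Fin.le_def] at hai hjc
  refine ⟨v * Equiv.swap a j, ⟨?_, ?_, ?_⟩, bruhatStep_mul_swap v ?_ ?_⟩
  · intro l r hlr
    rcases hmu hlr with ⟨rfl, rfl⟩ | hlr
    · simp
    · rw [Equiv.Perm.mul_apply, Equiv.swap_apply_of_ne_of_ne]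
      · exact hv.arc _ _ hlr
      · rintro rfl; exact ha ⟨l, hlr⟩
      · rintro rfl; exact hj ⟨l, hlr⟩
  · rintro p hp ⟨r, hr⟩
    have hpj : p ≠ j := by rintro rfl; exact hp ⟨_, hmem⟩
    have hp' : p ∉ lam.rightEnds := fun ⟨l, hl⟩ => hp ⟨l, hlam hl⟩
    rw [Equiv.Perm.mul_apply] at hr
    by_cases hpa : p = a
    · rw [hpa, Equiv.swap_apply_left] at hr
      rcases hmu hr with ⟨e, -⟩ | hr
      · rw [Fin.ext_iff] at e; omega
      · exact hv.not_mem j hj ⟨r, hr⟩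
    · rw [Equiv.swap_apply_of_ne_of_ne hpa hpj] at hr
      rcases hmu hr with ⟨e, -⟩ | hr
      · exact hpa (v.injective e)
      · exact hv.not_mem p hp' ⟨r, hr⟩
  · intro p hp
    have hpj : p ≠ j := by rintro rfl; exact hp ⟨_, hmem⟩
    have hp' : p ∉ lam.rightEnds := fun ⟨l, hl⟩ => hp ⟨l, hlam hl⟩
    rw [Equiv.Perm.mul_apply]
    by_cases hpa : p = a
    · rw [hpa, Equiv.swap_apply_left]
      exact ((hmono (hv.chain a ha)).tail hmem).trans
        (hmono (hv.chain j hj))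
    · rw [Equiv.swap_apply_of_ne_of_ne hpa hpj]
      exact hmono (hv.chain p hp')
  · rw [Fin.lt_def]; omega
  · rw [Fin.lt_def]; omega

/-- Swapping b and c sends c directly to a and makes b a fixed point, so chains that passed through
b now bypass it. -/
theorem IsRep.exists_of_splitsArc {lam mu : NCP n} {v : Equiv.Perm (Fin n)}
    (hv : IsRep lam v) (h : SplitsArc lam mu) : ∃ w, IsRep mu w ∧ BruhatStep v w := by
  obtain ⟨a, b, c, hab, hbc, hmem, h⟩ := h
  have hlam : ∀ {l r}, (l, r) ∈ lam.arcs → (l = a ∧ r = b) ∨ (l = b ∧ r = c) ∨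
      (l, r) ∈ mu.arcs := by
    intro l r hlr
    simp only [h, Finset.mem_insert, Finset.mem_erase, Prod.mk.injEq] at hlr
    tauto
  have hmu : ∀ {l r}, (l, r) ∈ mu.arcs → (l = a ∧ r = c) ∨ (l, r) ∈ lam.arcs := by
    intro l r hlr
    simp only [h, Finset.mem_insert, Finset.mem_erase, Prod.mk.injEq, ne_eq]
    tauto
  have hab' : (a, b) ∈ lam.arcs := by simp [h]
  have hbc' : (b, c) ∈ lam.arcs := by simp [h]
  have hbl : b ∉ mu.leftEnds := by
    rintro ⟨r, hr⟩
    rcases hmu hr with ⟨e, -⟩ | hr'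
    · exact hab.ne' e
    · rw [← lam.right_unique hbc' hr'] at hr
      exact hab.ne (mu.left_unique hmem hr)
  have hbr : b ∉ mu.rightEnds := by
    rintro ⟨l, hl⟩
    rcases hmu hl with ⟨-, e⟩ | hl'
    · exact hbc.ne e
    · rw [← lam.left_unique hab' hl'] at hl
      exact hbc.ne' (mu.right_unique hmem hl)
  have hvb := hv.arc _ _ hab'
  have hvc := hv.arc _ _ hbc'
  have hright : ∀ p, p ≠ b → p ∉ mu.rightEnds → p ∉ lam.rightEnds := by
    rintro p hpb hp ⟨l, hl⟩
    rcases hlam hl with ⟨-, e⟩ | ⟨-, rfl⟩ | hl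
    · exact hpb e
    · exact hp ⟨a, hmem⟩
    · exact hp ⟨l, hl⟩
  -- The second clause handles a chain already at b: its next point must be c, and (a, c) replaces
  -- the two short arcs.
  have hchain : ∀ p q, ReflTransGen (fun x y => (x, y) ∈ lam.arcs) p q → q ≠ b →
      (p ≠ b → ReflTransGen (fun x y => (x, y) ∈ mu.arcs) p q) ∧
      (p = b → ReflTransGen (fun x y => (x, y) ∈ mu.arcs) c q) := by
    intro p q hpq hq
    induction hpq using ReflTransGen.head_induction_on with
    | refl => exact ⟨fun _ => ReflTransGen.refl, fun e => absurd e hq⟩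
    | head hstep _ ih =>
      rcases hlam hstep with ⟨rfl, rfl⟩ | ⟨rfl, rfl⟩ | hstep'
      · exact ⟨fun _ => (ih.2 rfl).head hmem, fun e => absurd e hab.ne⟩
      · exact ⟨fun e => absurd rfl e, fun _ => ih.1 hbc.ne'⟩
      · refine ⟨fun _ => (ih.1 ?_).head hstep', ?_⟩
        · rintro rfl; exact hbr ⟨_, hstep'⟩
        · rintro rfl; exact absurd ⟨_, hstep'⟩ hbl
  refine ⟨v * Equiv.swap b c, ⟨?_, ?_, ?_⟩, bruhatStep_mul_swap v hbc (by rwa [hvb, hvc])⟩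
  · intro l r hlr
    rcases hmu hlr with ⟨rfl, rfl⟩ | hlr'
    · simpa using hvb
    · rw [Equiv.Perm.mul_apply]
      by_cases hrc : r = c
      · rw [hrc, Equiv.swap_apply_right, hvb]
        exact mu.left_unique hmem (hrc ▸ hlr)
      · rw [Equiv.swap_apply_of_ne_of_ne _ hrc]
        · exact hv.arc _ _ hlr'
        · rintro rfl; exact hbr ⟨l, hlr⟩
  · intro p hp
    rw [Equiv.Perm.mul_apply]
    by_cases hpb : p = b
    · rw [hpb, Equiv.swap_apply_left, hvc]
      exact hbl
    · have hpc : p ≠ c := by rintro rfl; exact hp ⟨a, hmem⟩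
      rw [Equiv.swap_apply_of_ne_of_ne hpb hpc]
      rintro ⟨r, hr⟩
      refine hv.not_mem p (hright p hpb hp) ?_
      rcases hmu hr with ⟨e, -⟩ | hr
      · exact ⟨b, e ▸ hab'⟩
      · exact ⟨r, hr⟩
  · intro p hp
    rw [Equiv.Perm.mul_apply]
    by_cases hpb : p = b
    · rw [hpb, Equiv.swap_apply_left, hvc]
    · have hpc : p ≠ c := by rintro rfl; exact hp ⟨a, hmem⟩
      rw [Equiv.swap_apply_of_ne_of_ne hpb hpc]
      refine (hchain p _ (hv.chain p (hright p hpb hp)) fun e => hpc ?_).1 hpb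
      exact v.injective (e.trans hvc.symm)

theorem IsRep.exists_of_prec {lam mu : NCP n} {v : Equiv.Perm (Fin n)} (hv : IsRep lam v)
    (h : Prec lam mu) : ∃ w, IsRep mu w ∧ BruhatLE v w := by
  induction h with
  | refl => exact ⟨v, hv, ReflTransGen.refl⟩
  | tail _ hstep ih =>
    obtain ⟨u, hu, hvu⟩ := ih
    obtain ⟨w, hw, huw⟩ :=
      hstep.elim hu.exists_of_removesShortArc hu.exists_of_splitsArc
    exact ⟨w, hw, hvu.tail huw⟩

/-- Existence needs no direct construction: start from the identity for the empty partition and lift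
covers. -/
theorem exists_isRep (lam : NCP n) : ∃ w, IsRep lam w := by
  have h1 : IsRep (noArcs n) 1 :=
    ⟨by simp [noArcs], by simp [noArcs, leftEnds], fun _ _ => ReflTransGen.refl⟩
  obtain ⟨w, hw, -⟩ := h1.exists_of_prec (noArcs_prec lam)
  exact ⟨w, hw⟩

/-! ### Comparison of the orders and classification of the classes -/

theorem classLE_iff_prec {lam mu : NCP n} :
    ClassLE (excClass lam) (excClass mu) ↔ Prec lam mu := by
  refine ⟨fun h => (dominated_of_classLE h).prec, fun h => ?_⟩
  obtain ⟨v, hv⟩ := exists_isRep lam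
  obtain ⟨w, hw, hvw⟩ := hv.exists_of_prec h
  exact ⟨v, hv.mem_excClass, w, hw.mem_excClass, hvw⟩

theorem excClass_injective : Function.Injective (excClass : NCP n → Set (Equiv.Perm (Fin n))) := by
  intro lam mu h
  obtain ⟨w, hw⟩ := exists_isRep lam
  have h1 := hw.mem_excClass
  have h2 := h ▸ h1
  exact ext_of_ends (compl_injective (h1.1.symm.trans h2.1))
    (compl_injective (h1.2.symm.trans h2.2))

theorem excClass_mem_classes (lam : NCP n) : excClass lam ∈ (excSetoid n).classes := by
  obtain ⟨w, hw⟩ := exists_isRep lam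
  have hw := hw.mem_excClass
  refine ⟨w, Set.ext fun x => ?_⟩
  change _ ↔ excVal x = excVal w ∧ excPos x = excPos w
  rw [hw.1, hw.2]
  rfl

/-- A permutation whose excedance class contains no longer permutation has noncrossing arcs. -/
theorem permArcs_noncrossing {w : Equiv.Perm (Fin n)}
    (hmax : ∀ v, (excSetoid n).r v w → length v ≤ length w) :
    ∀ a ∈ permArcs w, ∀ b ∈ permArcs w, a ≠ b → ¬ (a.1 ≤ b.1 ∧ b.1 < a.2 ∧ a.2 ≤ b.2) := by
  rintro ⟨i, k⟩ ha ⟨j, l⟩ hb hne ⟨hij, hjk, hkl⟩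
  simp only at hij hjk hkl
  obtain ⟨rfl, hik⟩ := mem_permArcs.1 ha
  obtain ⟨rfl, hjl⟩ := mem_permArcs.1 hb
  have hkl' : k < l := lt_of_le_of_ne hkl (by rintro rfl; exact hne rfl)
  have hw : w k < w l := lt_of_le_of_ne hij (w.injective.ne hkl'.ne)
  -- Exchanging the two left endpoints keeps both positions below the diagonal, because w k < w l <
  -- k < l; the class is unchanged but the length grows.
  refine absurd (hmax (w * Equiv.swap k l) ?_) (not_le.2 (length_lt_mul_swap w hkl' hw))
  have hval : ∀ p, p ≠ k → p ≠ l → (w * Equiv.swap k l) p = w p := fun p h1 h2 => by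
    rw [Equiv.Perm.mul_apply, Equiv.swap_apply_of_ne_of_ne h1 h2]
  have hk : (w * Equiv.swap k l) k = w l := by simp
  have hl : (w * Equiv.swap k l) l = w k := by simp
  have hkn : ¬ k ≤ w k := not_le.2 hik
  have hln : ¬ l ≤ w l := not_le.2 hjl
  have hkn' : ¬ k ≤ w l := not_le.2 hjk
  have hln' : ¬ l ≤ w k := not_le.2 (hw.trans hjl)
  have key : ∀ p, p ≤ (w * Equiv.swap k l) p ↔ p ≤ w p := by
    intro p
    by_cases h1 : p = k
    · subst h1; rw [hk]; tauto
    by_cases h2 : p = l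
    · subst h2; rw [hl]; tauto
    rw [hval p h1 h2]
  refine ⟨Set.ext fun x => exists_congr fun p => ?_, Set.ext key⟩
  rw [key]
  refine and_congr_right fun hp => ?_
  rw [hval p (by rintro rfl; exact hkn hp) (by rintro rfl; exact hln hp)]

theorem exists_excClass_eq {A : Set (Equiv.Perm (Fin n))} (hA : A ∈ (excSetoid n).classes) :
    ∃ lam : NCP n, excClass lam = A := by
  obtain ⟨u, rfl⟩ := hA
  obtain ⟨w, hw, hmax⟩ := Set.exists_max_image {x | (excSetoid n).r x u} length (Set.toFinite _)
    ⟨u, (excSetoid n).refl u⟩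
  refine ⟨⟨permArcs w, (isArcSet_permArcs w).lt, permArcs_noncrossing fun v hv =>
    hmax v ((excSetoid n).trans hv hw)⟩, Set.ext fun x => ?_⟩
  have hw1 : excVal w = excVal u := hw.1
  have hw2 : excPos w = excPos u := hw.2
  change _ ↔ excVal x = excVal u ∧ excPos x = excPos u
  rw [← hw1, ← hw2]
  refine and_congr (Eq.congr_right (Set.ext fun y => ?_)) (Eq.congr_right (Set.ext fun y => ?_))
  · rw [Set.mem_compl_iff, mem_leftEnds_iff, mem_image_fst_permArcs, not_not]
  · rw [Set.mem_compl_iff, mem_rightEnds_iff, mem_image_snd_permArcs, not_not]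

end ExcedanceQuotient

open ExcedanceQuotient in
theorem mainTheorem1 (n : ℕ) :
    -- the excedance classes are indexed bijectively by the noncrossing partitions
    Set.BijOn (excClass : NCP n → Set (Equiv.Perm (Fin n))) Set.univ (excSetoid n).classes ∧
    -- the induced relation on the classes is the order on noncrossing partitions
    (∀ lam mu : NCP n, ClassLE (excClass lam) (excClass mu) ↔ NCP.Prec lam mu) ∧
    -- the induced relation is a partial order on the set of excedance classes
    IsPartialOrder (excSetoid n).classes (fun A B => ClassLE A.1 B.1) := by
  refine ⟨⟨fun lam _ => excClass_mem_classes lam, excClass_injective.injOn, fun A hA => ?_⟩,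
    fun _ _ => classLE_iff_prec, ?_⟩
  · obtain ⟨lam, h⟩ := exists_excClass_eq hA
    exact ⟨lam, trivial, h⟩
  · refine { refl := ?_, trans := ?_, antisymm := ?_ }
    · rintro ⟨A, hA⟩
      obtain ⟨lam, rfl⟩ := exists_excClass_eq hA
      exact classLE_iff_prec.2 Relation.ReflTransGen.refl
    · rintro ⟨A, hA⟩ ⟨B, hB⟩ ⟨C, hC⟩ h1 h2
      obtain ⟨lam, rfl⟩ := exists_excClass_eq hA
      obtain ⟨mu, rfl⟩ := exists_excClass_eq hB
      obtain ⟨nu, rfl⟩ := exists_excClass_eq hC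
      -- The two relations may use different permutations of the middle class, so transitivity is
      -- taken from `Prec`.
      exact classLE_iff_prec.2 ((classLE_iff_prec.1 h1).trans (classLE_iff_prec.1 h2))
    · rintro ⟨A, hA⟩ ⟨B, hB⟩ h1 h2
      obtain ⟨lam, rfl⟩ := exists_excClass_eq hA
      obtain ⟨mu, rfl⟩ := exists_excClass_eq hB
      have := (dominated_of_classLE h1).antisymm (dominated_of_classLE h2)
      subst this
      rfl
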